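/- **Conventions.** An *Arf numerical semigroup* is a submonoid $T\subseteq\mathbb N$ with finite complement such that $T(s)-s=\{n-s: n\in T,\ n\ge s\}$ is closed under addition for all $s\in T$. Its *Arf characters* are the minimal generators of the smallest submonoid $N\subseteq\mathbb N$ for which the intersection of all Arf numerical semigroups containing $N$ is $T$. A submonoid $S\subseteq\mathbb N^d$ is *good* if (1) it is closed under coordinatewise minimum; (2) if $\alpha\ne\beta$ are in $S$ and $\alpha_i=\beta_i$, there is $\varepsilon\in S$ with $\varepsilon_i>\alpha_i$ and, for $j\ne i$, $\varepsilon_j\ge\min(\alpha_j,\beta_j)$, with equality if $\alpha_j\neq\beta_j$; (3) $\delta+\mathbb N^d\subseteq S$ for some $\delta\in\mathbb N^d$. It is *Arf* if it is good and $\{\beta\in\mathbb N^d:\alpha+\beta\in S\}$ is closed under addition for all $\alpha\in S$, and *local* if $0$ is its only element with a zero coordinate. Let $S$ be an Arf semigroup in $\mathbb N^d$, let $S_j=\{s_0^j=0<s_1^j<\cdots\}$ be its projection on the $j$-th coordinate and put $e_i^j=s_{i+1}^j-s_i^j$. Branches $j$ and $h$ are *glued at level $i$* if for every $k\le i$ no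 nonzero $\gamma\in\mathbb N^2$ with a zero coordinate is such that $(s_k^j,s_k^h)+\gamma$ lies in the projection of $S$ on the $j$-th and $h$-th coordinates. The *multiplicity tree* of $S$ has at level $i$ on branch $j$ the node labelled by the vector $\mathbf e^j_{(i)}$ whose $h$-th coordinate is $e_i^h$ if $j,h$ are glued at level $i$ and $0$ otherwise; branches glued at level $i$ share their node at level $i$. A node at level $i$ on branch $j$ *corresponds* to the vector $\mathbf e^j_{(0)}+\cdots+\mathbf e^j_{(i)}$. An ordering of the branches is *compatible* with $S$ if at each level the branches through each node are consecutive in the ordering. **Theorem 5.3.** Let $S\subseteq\mathbb N^d$ be a local Arf semigroup. There is an ordering of the branches compatible with $S$. Fix any such ordering. Build a set $V$ as follows. For each branch $j$ and each Arf character $c$ of $S_j$, take the vector of $S$ with $j$-th coordinate $c$ whose other coordinates are minimal. Say that a vector *covers* a pair $(a,b)$ of consecutive branches if it corresponds to a node whose path from the root contains a node of branch $a$ or of branch $b$ at a level where $a$ and $b$ are not glued, that is, to a node above the node where $a$ and $b$ split, on the side of $a$ or of $b$. Then, for some pairs of consecutive branches covered by none of these vectors, add a vector covering the pair, so that in the end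 every pair of consecutive branches is covered by a vector of $V$. Such sets $V$ exist, and each of them is a finite subset of $S$ such that $S$ is the smallest of all the Arf semigroups (local or not) of $\mathbb N^d$ that contain $V$ and are compatible with the fixed ordering. So $S$ is determined by finitely many data. -/

import Mathlib

namespace ArfSemigroup

/-! ### Numerical Arf semigroups and their Arf characters -/

/-- A numerical semigroup `T` (an additive submonoid of `ℕ` with finite complement) is Arf if,
for each `s ∈ T`, the set `T(s) - s = {a | s + a ∈ T}` is closed under addition. -/
def IsArfNumerical (T : AddSubmonoid ℕ) : Prop :=
  ((T : Set ℕ)ᶜ).Finite ∧ ∀ s ∈ T, ∀ a b : ℕ, s + a ∈ T → s + b ∈ T → s + (a + b) ∈ T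

/-- The intersection of all the numerical Arf semigroups containing `N`. -/
def arfClosure (N : AddSubmonoid ℕ) : AddSubmonoid ℕ :=
  sInf {T : AddSubmonoid ℕ | IsArfNumerical T ∧ N ≤ T}

/-- `c` belongs to the minimal system of generators of the submonoid `N` of `ℕ`: it is a nonzero
element which is not a sum of two nonzero elements. -/
def IsMinimalGenerator (N : AddSubmonoid ℕ) (c : ℕ) : Prop :=
  c ∈ N ∧ c ≠ 0 ∧ ∀ a ∈ N, ∀ b ∈ N, a ≠ 0 → b ≠ 0 → a + b ≠ c

/-- The Arf characters (Arf system of generators) of `T`: the minimal system of generators of the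
smallest semigroup `N` whose Arf closure is `T`. -/
def arfCharacters (T : AddSubmonoid ℕ) : Set ℕ :=
  {c | ∃ N : AddSubmonoid ℕ, IsLeast {N' : AddSubmonoid ℕ | arfClosure N' = T} N ∧
    IsMinimalGenerator N c}

/-! ### Good, local and Arf subsemigroups of `ℕ^d` -/

/-- Good semigroups of `ℕ^d`. -/
structure IsGood {d : ℕ} (S : AddSubmonoid (Fin d → ℕ)) : Prop where
  inf_mem : ∀ α ∈ S, ∀ β ∈ S, α ⊓ β ∈ S
  exists_gt : ∀ α ∈ S, ∀ β ∈ S, α ≠ β → ∀ i, α i = β i →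
    ∃ ε ∈ S, α i < ε i ∧ ∀ j, j ≠ i →
      min (α j) (β j) ≤ ε j ∧ (α j ≠ β j → ε j = min (α j) (β j))
  exists_conductor : ∃ δ : Fin d → ℕ, ∀ α, δ ≤ α → α ∈ S

/-- A good semigroup `S` is Arf if, for each `α ∈ S`, the set `S(α) - α = {β | α + β ∈ S}` is
closed under addition. -/
structure IsArf {d : ℕ} (S : AddSubmonoid (Fin d → ℕ)) : Prop where
  good : IsGood S
  add_mem : ∀ α ∈ S, ∀ β γ : Fin d → ℕ, α + β ∈ S → α + γ ∈ S → α + (β + γ) ∈ S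

/-- Locality: no nonzero element of the set has a coordinate equal to `0`. -/
def IsLocal {d : ℕ} (S : Set (Fin d → ℕ)) : Prop :=
  ∀ α ∈ S, (∃ i, α i = 0) → α = 0

/-! ### The multiplicity tree -/

/-- The projection `S_j` of `S` on the `j`-th coordinate. -/
def proj {d : ℕ} (S : AddSubmonoid (Fin d → ℕ)) (j : Fin d) : AddSubmonoid ℕ :=
  S.map (Pi.evalAddMonoidHom (fun _ => ℕ) j)

/-- The multiplicity sequence `e_0^j, e_1^j, …` of `S_j = {s_0 = 0 < s_1 < s_2 < …}`, given by
`e_i^j = s_{i+1} - s_i`. -/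
noncomputable def mult {d : ℕ} (S : AddSubmonoid (Fin d → ℕ)) (j : Fin d) (i : ℕ) : ℕ :=
  Nat.nth (· ∈ proj S j) (i + 1) - Nat.nth (· ∈ proj S j) i

/-- The projection of `S` on the `jh`-plane, cut at `(a, b)` and translated by `-(a, b)`:
all pairs `γ` such that `(a, b) + γ` is in the projection of `S`. -/
def planeTranslate {d : ℕ} (S : AddSubmonoid (Fin d → ℕ)) (j h : Fin d) (a b : ℕ) :
    Set (Fin 2 → ℕ) :=
  {γ | ∃ β ∈ S, β j = a + γ 0 ∧ β h = b + γ 1}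

/-- The `j`-th and the `h`-th branch of the multiplicity tree are glued in a node at level `i`:
for every `k ≤ i`, with `(a, b) = (e_0^j, e_0^h) + ⋯ + (e_{k-1}^j, e_{k-1}^h)`, the translate by
`-(a, b)` of the part above `(a, b)` of the projection of `S` on the `jh`-plane is local. -/
def Glued {d : ℕ} (S : AddSubmonoid (Fin d → ℕ)) (j h : Fin d) (i : ℕ) : Prop :=
  ∀ k ≤ i, IsLocal (planeTranslate S j h
    (∑ t ∈ Finset.range k, mult S j t) (∑ t ∈ Finset.range k, mult S h t))

open Classical in
/-- The label of the node at level `i` on the `j`-th branch: its `h`-th coordinate is `e_i^h` if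
the `h`-th branch goes through this node and `0` otherwise. -/
noncomputable def node {d : ℕ} (S : AddSubmonoid (Fin d → ℕ)) (j : Fin d) (i : ℕ) : Fin d → ℕ :=
  fun h => if Glued S j h i then mult S h i else 0

/-- The vector corresponding to the node at level `i` on the `j`-th branch: the sum of the labels
along the path from the root to this node. -/
noncomputable def nodeVector {d : ℕ} (S : AddSubmonoid (Fin d → ℕ)) (j : Fin d) (i : ℕ) :
    Fin d → ℕ :=
  ∑ k ∈ Finset.range (i + 1), node S j k

/-- An ordering of the branches (`pos j` is the place of the `j`-th branch) is compatible with the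
tree of `S` if the branches through each node are consecutive. -/
def Compatible {d : ℕ} (pos : Equiv.Perm (Fin d)) (S : AddSubmonoid (Fin d → ℕ)) : Prop :=
  ∀ j h l : Fin d, pos j ≤ pos h → pos h ≤ pos l → ∀ i, Glued S j l i → Glued S j h i

/-- The `a`-th branch is immediately followed by the `b`-th branch. -/
def Consecutive {d : ℕ} (pos : Equiv.Perm (Fin d)) (a b : Fin d) : Prop :=
  (pos b : ℕ) = (pos a : ℕ) + 1

/-! ### The set `V` -/

/-- The vectors of `S` with `j`-th coordinate an Arf character of `S_j` and the other coordinates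
minimal, for all `j`. -/
def minimalVectors {d : ℕ} (S : AddSubmonoid (Fin d → ℕ)) : Set (Fin d → ℕ) :=
  {v | ∃ j : Fin d, ∃ c ∈ arfCharacters (proj S j), IsLeast {α | α ∈ S ∧ α j = c} v}

/-- `v` corresponds to a node (at level `i` on the `l`-th branch) lying over the node where the
`a`-th and `b`-th branches split, on the side of one of these two branches: the path from the root
to this node contains a node of one of these two branches, at a level `k` where they are no longer
glued. -/
def OverBranching {d : ℕ} (S : AddSubmonoid (Fin d → ℕ)) (a b : Fin d) (v : Fin d → ℕ) : Prop :=
  ∃ (l : Fin d) (i : ℕ), v = nodeVector S l i ∧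
    ∃ k ≤ i, ¬ Glued S a b k ∧ (Glued S l a k ∨ Glued S l b k)

/-- `V` results from the construction: to the minimal vectors one adds vectors `w p`, for some
pairs `p` of consecutive branches whose branching node has none of the minimal vectors over it,
until all the branching nodes of pairs of consecutive branches have a vector of `V` over them. -/
def IsCharacterSet {d : ℕ} (pos : Equiv.Perm (Fin d)) (S : AddSubmonoid (Fin d → ℕ))
    (V : Set (Fin d → ℕ)) : Prop :=
  ∃ (J : Set (Fin d × Fin d)) (w : Fin d × Fin d → Fin d → ℕ),
    (∀ p ∈ J, Consecutive pos p.1 p.2 ∧ (¬ ∃ v ∈ minimalVectors S, OverBranching S p.1 p.2 v) ∧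
      OverBranching S p.1 p.2 (w p)) ∧
    V = minimalVectors S ∪ w '' J ∧
    ∀ a b : Fin d, Consecutive pos a b → ∃ v ∈ V, OverBranching S a b v

end ArfSemigroup

namespace ArfSemigroup

/-! ### Arf characters of a numerical Arf semigroup -/

/-! An Arf semigroup is determined by its projections and its gluing (`IsArf.mem_of_glued`). Minima
and the Arf property reduce membership to pairs of coordinates (`IsMinArf.mem_of_pairs`). For a pair
of branches splitting at level `k`, the semigroup contains two vectors at `s_k` on one branch with
different coordinates on the other; adding their difference repeatedly makes the other coordinate as
large as desired (`IsMinArf.exists_stretch`), so above the split the two coordinates are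
independent.

For minimality, let `A` be a compatible Arf semigroup containing `V`, and let `α ∈ S`. The Arf
characters of a projection are its essential elements, and any Arf numerical semigroup containing
them contains the whole projection; hence the minimal vectors force the projections of `S` into
those of `S ⊓ A`. Compatibility of `A` leaves only consecutive pairs to check. A covering vector
sits at `s_k` on one branch and beyond it on the other, so `A` can realize both coordinates of `α`
on such a pair. By `IsArf.mem_of_glued` applied to `A`, `α ∈ A`. -/

theorem arfClosure_le {N T : AddSubmonoid ℕ} (hT : IsArfNumerical T) (h : N ≤ T) :
    arfClosure N ≤ T :=
  sInf_le ⟨hT, h⟩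

theorem le_arfClosure (N : AddSubmonoid ℕ) : N ≤ arfClosure N :=
  le_sInf fun _ h => h.2

/-- The elements of `T` that are not in the Arf closure of the set of smaller elements of `T`. -/
def essential (T : AddSubmonoid ℕ) : Set ℕ :=
  {c | c ∈ T ∧ c ∉ arfClosure (AddSubmonoid.closure {t | t ∈ T ∧ t < c})}

/-- The submonoid obtained from `A` by adding all the integers greater than `c`. -/
def fillAbove (A : AddSubmonoid ℕ) (c : ℕ) : AddSubmonoid ℕ where
  carrier := {n | n ∈ A ∨ c < n}
  zero_mem' := Or.inl A.zero_mem
  add_mem' := by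
    rintro a b (ha | ha) (hb | hb)
    · exact Or.inl (A.add_mem ha hb)
    all_goals exact Or.inr (by omega)

theorem mem_fillAbove {A : AddSubmonoid ℕ} {c n : ℕ} : n ∈ fillAbove A c ↔ n ∈ A ∨ c < n :=
  Iff.rfl

theorem IsArfNumerical.fillAbove {A : AddSubmonoid ℕ} (hA : IsArfNumerical A) (c : ℕ) :
    IsArfNumerical (fillAbove A c) := by
  refine ⟨hA.1.subset fun n hn h => hn (Or.inl h), ?_⟩
  rintro s hs a b ha hb
  rw [mem_fillAbove] at *
  by_cases h : c < s + (a + b)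
  · exact Or.inr h
  · refine Or.inl (hA.2 s (hs.resolve_right ?_) a b (ha.resolve_right ?_) (hb.resolve_right ?_))
    all_goals omega

/-- If `c ∉ N`, any Arf `A` containing the elements of `T` below `c` gives an Arf semigroup
`fillAbove A c` containing `N`, hence `T`; so `c ∈ A` for every such `A`, and `c` is not essential.
-/
theorem essential_subset {T N : AddSubmonoid ℕ} (h : arfClosure N = T) :
    essential T ⊆ N := by
  rintro c ⟨hcT, hc⟩
  by_contra hcN
  apply hc
  refine AddSubmonoid.mem_sInf.2 fun A hA => ?_
  have hle : N ≤ fillAbove A c := by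
    intro n hn
    rcases lt_trichotomy n c with hlt | rfl | hlt
    · exact Or.inl (hA.2 (AddSubmonoid.subset_closure ⟨h ▸ le_arfClosure N hn, hlt⟩))
    · exact absurd hn hcN
    · exact Or.inr hlt
  have := arfClosure_le (hA.1.fillAbove c) hle (h ▸ hcT)
  exact this.resolve_right (lt_irrefl c)

theorem le_of_essential_subset {T R : AddSubmonoid ℕ} (hR : IsArfNumerical R)
    (h : essential T ⊆ R) : T ≤ R := by
  intro t
  induction t using Nat.strong_induction_on with
  | _ t ih =>
    intro ht
    by_cases hess : t ∈ essential T
    · exact h hess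
    · have : t ∈ arfClosure (AddSubmonoid.closure {u | u ∈ T ∧ u < t}) := by
        by_contra hc
        exact hess ⟨ht, hc⟩
      exact arfClosure_le hR ((AddSubmonoid.closure_le).2 fun u hu => ih u hu.2 hu.1) this

theorem isLeast_closure_essential {T : AddSubmonoid ℕ} (hT : IsArfNumerical T) :
    IsLeast {N : AddSubmonoid ℕ | arfClosure N = T} (AddSubmonoid.closure (essential T)) := by
  refine ⟨le_antisymm (arfClosure_le hT ((AddSubmonoid.closure_le).2 fun _ h => h.1)) ?_,
    fun N hN => (AddSubmonoid.closure_le).2 (essential_subset hN)⟩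
  exact le_sInf fun R hR => le_of_essential_subset hR.1
    ((AddSubmonoid.subset_closure).trans hR.2)

theorem mem_of_isMinimalGenerator {s : Set ℕ} {c : ℕ}
    (h : IsMinimalGenerator (AddSubmonoid.closure s) c) : c ∈ s := by
  obtain ⟨hc, h0, hmin⟩ := h
  by_contra hcs
  have key : ∀ x ∈ AddSubmonoid.closure s, x ≠ c := by
    intro x hx
    induction hx using AddSubmonoid.closure_induction with
    | mem x hx => rintro rfl; exact hcs hx
    | zero => exact fun h => h0 h.symm
    | add x y hx hy ihx ihy =>
      rcases eq_or_ne x 0 with rfl | hx0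
      · simpa using ihy
      rcases eq_or_ne y 0 with rfl | hy0
      · simpa using ihx
      exact hmin x hx y hy hx0 hy0
  exact key c hc rfl

theorem arfCharacters_eq_essential {T : AddSubmonoid ℕ} (hT : IsArfNumerical T) :
    arfCharacters T = essential T := by
  have hleast := isLeast_closure_essential hT
  ext c
  constructor
  · rintro ⟨N, hN, hc⟩
    rw [hN.unique hleast] at hc
    exact mem_of_isMinimalGenerator hc
  · intro hc
    have hle : AddSubmonoid.closure (essential T) ≤ T :=
      (AddSubmonoid.closure_le).2 fun _ h => h.1
    refine ⟨_, hleast, AddSubmonoid.subset_closure hc, ?_, ?_⟩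
    · rintro rfl
      exact hc.2 (zero_mem _)
    · intro a ha b hb ha0 hb0 hab
      refine hc.2 (le_arfClosure _ ?_)
      rw [← hab]
      exact add_mem (AddSubmonoid.subset_closure ⟨hle ha, by omega⟩)
        (AddSubmonoid.subset_closure ⟨hle hb, by omega⟩)

theorem finite_arfCharacters {T : AddSubmonoid ℕ} (hT : IsArfNumerical T) :
    (arfCharacters T).Finite := by
  rw [arfCharacters_eq_essential hT]
  obtain ⟨m, hm⟩ := hT.1.bddAbove
  have hmem : ∀ n, m < n → n ∈ T := fun n hn => by
    by_contra h
    exact absurd (hm h) (by omega)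
  refine (Set.finite_Iic (m + 2)).subset fun c hc => ?_
  by_contra hlt
  simp only [Set.mem_Iic, not_le] at hlt
  refine hc.2 (AddSubmonoid.mem_sInf.2 fun A hA => ?_)
  have hA' : ∀ n, m < n → n < c → n ∈ A := fun n h1 h2 =>
    hA.2 (AddSubmonoid.subset_closure ⟨hmem n h1, h2⟩)
  -- The elements `m + 1`, `m + 2` and `c - 1` all lie in `A`, and `c = (m + 2) + (c - 1) - (m +
  -- 1)`.
  have := hA.1.2 (m + 1) (hA' _ (by omega) (by omega)) 1 (c - m - 2)
    (hA' _ (by omega) (by omega)) (hA' _ (by omega) (by omega))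
  convert this using 1
  omega

/-! ### Submonoids closed under minima and satisfying the Arf property -/

variable {d : ℕ}

/-- The part of the properties of an Arf semigroup that is stable under intersections. -/
structure IsMinArf (S : AddSubmonoid (Fin d → ℕ)) : Prop where
  inf_mem : ∀ α ∈ S, ∀ β ∈ S, α ⊓ β ∈ S
  exists_conductor : ∃ δ : Fin d → ℕ, ∀ α, δ ≤ α → α ∈ S
  add_mem : ∀ α ∈ S, ∀ β γ : Fin d → ℕ, α + β ∈ S → α + γ ∈ S → α + (β + γ) ∈ S

theorem IsArf.isMinArf {S : AddSubmonoid (Fin d → ℕ)} (hS : IsArf S) : IsMinArf S :=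
  ⟨hS.good.inf_mem, hS.good.exists_conductor, hS.add_mem⟩

namespace IsMinArf

variable {S A : AddSubmonoid (Fin d → ℕ)}

theorem inter (hS : IsMinArf S) (hA : IsMinArf A) : IsMinArf (S ⊓ A) := by
  refine ⟨fun α hα β hβ => ⟨hS.inf_mem α hα.1 β hβ.1, hA.inf_mem α hα.2 β hβ.2⟩, ?_,
    fun α hα β γ hβ hγ =>
      ⟨hS.add_mem α hα.1 β γ hβ.1 hγ.1, hA.add_mem α hα.2 β γ hβ.2 hγ.2⟩⟩
  obtain ⟨δ, hδ⟩ := hS.exists_conductor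
  obtain ⟨δ', hδ'⟩ := hA.exists_conductor
  exact ⟨δ ⊔ δ', fun α hα =>
    ⟨hδ α (le_sup_left.trans hα), hδ' α (le_sup_right.trans hα)⟩⟩

/-- The Arf property with differences: `β + γ - μ ∈ S` for `μ ≤ β, γ`. -/
theorem add_sub_mem (hS : IsMinArf S) {μ β γ : Fin d → ℕ} (hμ : μ ∈ S) (hβ : β ∈ S) (hγ : γ ∈ S)
    (h1 : μ ≤ β) (h2 : μ ≤ γ) : β + (γ - μ) ∈ S := by
  have := hS.add_mem μ hμ (β - μ) (γ - μ) (by rwa [add_tsub_cancel_of_le h1])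
    (by rwa [add_tsub_cancel_of_le h2])
  rwa [← add_assoc, add_tsub_cancel_of_le h1] at this

theorem add_sum_sub_mem (hS : IsMinArf S) {ι : Type*} (s : Finset ι) {μ β : Fin d → ℕ}
    (hμ : μ ∈ S) (hβ : β ∈ S) (h : μ ≤ β) (f : ι → Fin d → ℕ) (hf : ∀ i ∈ s, f i ∈ S)
    (hle : ∀ i ∈ s, μ ≤ f i) : β + ∑ i ∈ s, (f i - μ) ∈ S := by
  classical
  induction s using Finset.induction_on with
  | empty => simpa using hβ
  | insert i s hi ih =>
    rw [Finset.sum_insert hi, add_comm (f i - μ), ← add_assoc]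
    exact hS.add_sub_mem hμ (ih (fun j hj => hf j (Finset.mem_insert_of_mem hj))
      (fun j hj => hle j (Finset.mem_insert_of_mem hj))) (hf i (Finset.mem_insert_self i s))
      (h.trans le_self_add) (hle i (Finset.mem_insert_self i s))

theorem inf'_mem (hS : IsMinArf S) {ι : Type*} (s : Finset ι) (hs : s.Nonempty)
    (f : ι → Fin d → ℕ) (hf : ∀ i ∈ s, f i ∈ S) : s.inf' hs f ∈ S :=
  Finset.inf'_induction hs f (p := (· ∈ S)) (fun α hα β hβ => hS.inf_mem α hα β hβ) hf

/-- Membership can be tested on pairs of coordinates. -/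
theorem mem_of_pairs (hS : IsMinArf S) {α : Fin d → ℕ}
    (h : ∀ a b, ∃ β ∈ S, β a = α a ∧ α b ≤ β b) : α ∈ S := by
  rcases isEmpty_or_nonempty (Fin d) with hd | hd
  · rw [Subsingleton.elim α 0]
    exact S.zero_mem
  -- For fixed `a`, the differences `β b - μ` vanish at `a`, so adding all of them to the minimum
  -- `μ` raises every coordinate to at least that of `α` and keeps the `a`-th one. The minimum of
  -- these vectors over `a` is `α`.
  have key : ∀ a, ∃ y ∈ S, y a = α a ∧ α ≤ y := by
    intro a
    choose β hβ hβa hβb using h a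
    set μ := Finset.univ.inf' Finset.univ_nonempty β with hμ
    have hμS : μ ∈ S := hS.inf'_mem _ _ _ fun i _ => hβ i
    have hμle : ∀ b, μ ≤ β b := fun b => Finset.inf'_le _ (Finset.mem_univ b)
    have hμa : μ a = α a := by
      rw [hμ, Finset.inf'_apply]
      simp [hβa]
    refine ⟨_, hS.add_sum_sub_mem Finset.univ hμS hμS le_rfl β (fun b _ => hβ b)
      (fun b _ => hμle b), ?_, fun b => ?_⟩
    · simp [Finset.sum_apply, hμa, hβa]
    · have h1 : (β b - μ) b ≤ ∑ c, (β c - μ) b :=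
        Finset.single_le_sum (f := fun c => (β c - μ) b) (fun _ _ => Nat.zero_le _)
          (Finset.mem_univ b)
      have h2 := hμle b b
      have h3 := hβb b
      simp only [Pi.add_apply, Finset.sum_apply, Pi.sub_apply] at h1 ⊢
      omega
  choose y hy hya hle using key
  have : α = Finset.univ.inf' Finset.univ_nonempty y := by
    refine le_antisymm (Finset.le_inf' _ _ fun a _ => hle a) fun a => ?_
    rw [← hya a]
    exact Finset.inf'_le y (Finset.mem_univ a) a
  rw [this]
  exact hS.inf'_mem _ _ _ fun i _ => hy i

/-- If `S` contains vectors `σ, ρ` with the same `a`-th coordinate and `σ b < ρ b`, then the `b`-th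
coordinate of the vectors above them can be increased without changing the `a`-th one. -/
theorem exists_stretch (hS : IsMinArf S) {a b : Fin d} {σ ρ β : Fin d → ℕ} (hσ : σ ∈ S)
    (hρ : ρ ∈ S) (hβ : β ∈ S) (ha : ρ a = σ a) (hb : σ b < ρ b) (hβa : σ a ≤ β a)
    (N : ℕ) : ∃ ε ∈ S, ε a = β a ∧ N ≤ ε b := by
  have hμ : σ ⊓ ρ ⊓ β ∈ S := hS.inf_mem _ (hS.inf_mem σ hσ ρ hρ) β hβ
  refine ⟨_, hS.add_sum_sub_mem (Finset.range N) hμ hβ inf_le_right (fun _ => ρ)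
    (fun _ _ => hρ) (fun _ _ => inf_le_left.trans inf_le_right), ?_, ?_⟩
  · simp [ha, hβa]
  · simp only [Finset.sum_const, Finset.card_range, Pi.add_apply, Pi.smul_apply, Pi.sub_apply,
      Pi.inf_apply, smul_eq_mul]
    have : 1 ≤ ρ b - σ b ⊓ ρ b ⊓ β b := by
      have : σ b ⊓ ρ b ⊓ β b ≤ σ b := inf_le_left.trans inf_le_left
      omega
    nlinarith

end IsMinArf

theorem mem_proj {S : AddSubmonoid (Fin d → ℕ)} {j : Fin d} {x : ℕ} :
    x ∈ proj S j ↔ ∃ β ∈ S, β j = x :=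
  AddSubmonoid.mem_map

theorem apply_mem_proj {S : AddSubmonoid (Fin d → ℕ)} {β : Fin d → ℕ} (hβ : β ∈ S) (j : Fin d) :
    β j ∈ proj S j :=
  mem_proj.2 ⟨β, hβ, rfl⟩

namespace IsMinArf

variable {S A : AddSubmonoid (Fin d → ℕ)}

theorem finite_compl_proj (hS : IsMinArf S) (j : Fin d) : ((proj S j : Set ℕ)ᶜ).Finite := by
  obtain ⟨δ, hδ⟩ := hS.exists_conductor
  refine (Set.finite_Iio (δ j)).subset fun x hx => ?_
  by_contra hlt
  simp only [Set.mem_Iio, not_lt] at hlt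
  refine hx (mem_proj.2 ⟨Function.update δ j x, hδ _ ?_, by simp⟩)
  rw [le_update_iff]
  exact ⟨hlt, fun _ _ => le_rfl⟩

/-- Lifts of the three elements need not be comparable; replacing the lift of `s` by its minimum
with the other two keeps its `j`-th coordinate and makes the Arf property applicable. -/
theorem isArfNumerical_proj (hS : IsMinArf S) (j : Fin d) : IsArfNumerical (proj S j) := by
  refine ⟨hS.finite_compl_proj j, fun s hs x y hx hy => ?_⟩
  obtain ⟨σ, hσ, rfl⟩ := mem_proj.1 hs
  obtain ⟨β, hβ, hβj⟩ := mem_proj.1 hx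
  obtain ⟨γ, hγ, hγj⟩ := mem_proj.1 hy
  refine mem_proj.2 ⟨_, hS.add_sub_mem (hS.inf_mem _ (hS.inf_mem σ hσ β hβ) γ hγ) hβ hγ
    (inf_le_left.trans inf_le_right) inf_le_right, ?_⟩
  simp only [Pi.add_apply, Pi.sub_apply, Pi.inf_apply, hβj, hγj]
  rw [inf_eq_left.2 (by omega), inf_eq_left.2 (by omega)]
  omega

end IsMinArf

/-! ### Levels and gluing -/

/-- The element `s_i` of the projection `S_j = {s_0 < s_1 < ⋯}`. -/
noncomputable def level (S : AddSubmonoid (Fin d → ℕ)) (j : Fin d) (i : ℕ) : ℕ :=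
  Nat.nth (· ∈ proj S j) i

namespace IsMinArf

variable {S A : AddSubmonoid (Fin d → ℕ)}

theorem infinite_proj (hS : IsMinArf S) (j : Fin d) : {x | x ∈ proj S j}.Infinite :=
  fun h => Set.infinite_univ ((h.union (hS.finite_compl_proj j)).subset fun x _ => by
    by_cases hx : x ∈ proj S j
    · exact Or.inl hx
    · exact Or.inr hx)

theorem level_strictMono (hS : IsMinArf S) (j : Fin d) : StrictMono (level S j) :=
  Nat.nth_strictMono (hS.infinite_proj j)

theorem level_mem (hS : IsMinArf S) (j : Fin d) (i : ℕ) : level S j i ∈ proj S j :=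
  Nat.nth_mem_of_infinite (hS.infinite_proj j) i

theorem exists_level_eq {j : Fin d} {x : ℕ} (hS : IsMinArf S) (hx : x ∈ proj S j) :
    ∃ n, level S j n = x := by
  have : x ∈ Set.range (Nat.nth (· ∈ proj S j)) := by
    rwa [Nat.range_nth_of_infinite (hS.infinite_proj j)]
  exact this

theorem level_zero (hS : IsMinArf S) (j : Fin d) : level S j 0 = 0 := by
  obtain ⟨n, hn⟩ := hS.exists_level_eq (zero_mem (proj S j))
  have := (hS.level_strictMono j).monotone (Nat.zero_le n)
  omega

theorem level_le_level (hS : IsMinArf S) {j : Fin d} {m n : ℕ} :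
    level S j m ≤ level S j n ↔ m ≤ n :=
  (hS.level_strictMono j).le_iff_le

theorem level_succ_le (hS : IsMinArf S) {j : Fin d} {n x : ℕ} (hx : x ∈ proj S j) :
    level S j (n + 1) ≤ x ↔ level S j n < x := by
  obtain ⟨m, rfl⟩ := hS.exists_level_eq hx
  rw [hS.level_le_level, (hS.level_strictMono j).lt_iff_lt, Nat.succ_le_iff]

theorem sum_mult (hS : IsMinArf S) (j : Fin d) (k : ℕ) :
    ∑ t ∈ Finset.range k, mult S j t = level S j k := by
  induction k with
  | zero => simp [hS.level_zero]
  | succ k ih =>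
    rw [Finset.sum_range_succ, ih]
    exact Nat.add_sub_cancel' ((hS.level_strictMono j).monotone k.le_succ)

/-- Two branches are glued at level `i` if and only if, for each `k ≤ i`, the vectors of `S` exceed
the `k`-th element of one of the two projections when they exceed that of the other one. -/
theorem glued_iff (hS : IsMinArf S) {a b : Fin d} {i : ℕ} :
    Glued S a b i ↔
      ∀ k ≤ i, ∀ β ∈ S, (level S a (k + 1) ≤ β a ↔ level S b (k + 1) ≤ β b) := by
  constructor
  · intro h k
    induction k with
    | zero =>
      intro hk β hβ
      have hloc := h 0 hk ![β a, β b] ⟨β, hβ, by simp, by simp⟩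
      rw [hS.level_succ_le (apply_mem_proj hβ a), hS.level_succ_le (apply_mem_proj hβ b),
        hS.level_zero, hS.level_zero]
      constructor <;> intro hpos <;> by_contra h0
      · have := congrFun (hloc ⟨1, by simpa using h0⟩) 0
        simp at this
        omega
      · have := congrFun (hloc ⟨0, by simpa using h0⟩) 1
        simp at this
        omega
    | succ k ih =>
      intro hk β hβ
      have ih' := ih (by omega) β hβ
      by_cases hle : level S a (k + 1) ≤ β a
      · have hle' := ih'.1 hle
        have hloc := h (k + 1) hk ![β a - level S a (k + 1), β b - level S b (k + 1)]
          ⟨β, hβ, by simp [hS.sum_mult]; omega, by simp [hS.sum_mult]; omega⟩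
        rw [hS.level_succ_le (apply_mem_proj hβ a), hS.level_succ_le (apply_mem_proj hβ b)]
        constructor <;> intro hpos <;> by_contra h0
        · have := congrFun (hloc ⟨1, by simp; omega⟩) 0
          simp at this
          omega
        · have := congrFun (hloc ⟨0, by simp; omega⟩) 1
          simp at this
          omega
      -- Both coordinates are still below the previous level, so both sides of the equivalence fail.
      · have hle' := mt ih'.2 hle
        have h1 := (hS.level_strictMono a) (Nat.lt_add_one (k + 1))
        have h2 := (hS.level_strictMono b) (Nat.lt_add_one (k + 1))
        constructor <;> intro <;> omega
  · intro h k hk γ hγ hz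
    obtain ⟨β, hβ, hβa, hβb⟩ := hγ
    rw [hS.sum_mult] at hβa hβb
    have := h k hk β hβ
    rw [hS.level_succ_le (apply_mem_proj hβ a), hS.level_succ_le (apply_mem_proj hβ b),
      hβa, hβb] at this
    rw [Fin.exists_fin_two] at hz
    ext t
    fin_cases t <;> simp <;> omega

theorem glued_mono {a b : Fin d} {i k : ℕ} (hk : k ≤ i) (h : Glued S a b i) : Glued S a b k :=
  fun t ht => h t (ht.trans hk)

theorem glued_refl (hS : IsMinArf S) (a : Fin d) (i : ℕ) : Glued S a a i :=
  hS.glued_iff.2 fun _ _ _ _ => Iff.rfl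

theorem glued_symm (hS : IsMinArf S) {a b : Fin d} {i : ℕ} (h : Glued S a b i) : Glued S b a i :=
  hS.glued_iff.2 fun k hk β hβ => (hS.glued_iff.1 h k hk β hβ).symm

theorem glued_trans (hS : IsMinArf S) {a b c : Fin d} {i : ℕ} (h : Glued S a b i)
    (h' : Glued S b c i) : Glued S a c i :=
  hS.glued_iff.2 fun k hk β hβ =>
    (hS.glued_iff.1 h k hk β hβ).trans (hS.glued_iff.1 h' k hk β hβ)

theorem level_le_iff (hS : IsMinArf S) {a b : Fin d} {k : ℕ} (h : ∀ t < k, Glued S a b t)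
    {β : Fin d → ℕ} (hβ : β ∈ S) : level S a k ≤ β a ↔ level S b k ≤ β b := by
  rcases k with _ | k
  · simp [hS.level_zero]
  · exact hS.glued_iff.1 (h k k.lt_succ_self) k le_rfl β hβ

/-- Distinct branches are eventually not glued. -/
theorem exists_not_glued (hS : IsMinArf S) {a b : Fin d} (hab : a ≠ b) : ∃ k, ¬ Glued S a b k := by
  obtain ⟨δ, hδ⟩ := hS.exists_conductor
  obtain ⟨n, hn⟩ := hS.exists_level_eq (apply_mem_proj (hδ δ le_rfl) a)
  refine ⟨n, fun h => ?_⟩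
  have hmem : Function.update δ b (δ b + level S b (n + 1)) ∈ S :=
    hδ _ (le_update_iff.2 ⟨le_self_add, fun _ _ => le_rfl⟩)
  have := (hS.glued_iff.1 h n le_rfl _ hmem).2 (by simp)
  rw [Function.update_of_ne hab, ← hn, hS.level_le_level] at this
  omega

/-- The vector through the first elements of two branches up to the splitting level. -/
theorem exists_apply_eq_level (hS : IsMinArf S) {a b : Fin d} {k : ℕ}
    (h : ∀ t < k, Glued S a b t) (hA : IsMinArf A) (hAS : A ≤ S)
    (ha : level S a k ∈ proj A a) (hb : level S b k ∈ proj A b) :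
    ∃ σ ∈ A, σ a = level S a k ∧ σ b = level S b k := by
  obtain ⟨β, hβ, hβa⟩ := mem_proj.1 ha
  obtain ⟨γ, hγ, hγb⟩ := mem_proj.1 hb
  have h1 := (hS.level_le_iff h (hAS hβ)).1 hβa.ge
  have h2 := (hS.level_le_iff h (hAS hγ)).2 hγb.ge
  exact ⟨β ⊓ γ, hA.inf_mem β hβ γ hγ, by simp [hβa, h2], by simp [hγb, h1]⟩

end IsMinArf

/-- Property (2) of good semigroups, applied at `b`, reverses the side on which two vectors differ.
It enters the proof only here. -/
theorem IsGood.exists_swap {S : AddSubmonoid (Fin d → ℕ)} (hS : IsGood S) {a b : Fin d}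
    {σ τ : Fin d → ℕ} (hσ : σ ∈ S) (hτ : τ ∈ S) (ha : σ a < τ a) (hb : τ b = σ b) :
    ∃ ρ ∈ S, ρ a = σ a ∧ σ b < ρ b := by
  have hne : σ ≠ τ := fun h => by simp [h] at ha
  have hab : a ≠ b := by
    rintro rfl
    omega
  obtain ⟨ρ, hρ, hgt, h⟩ := hS.exists_gt σ hσ τ hτ hne b hb.symm
  exact ⟨ρ, hρ, by rw [(h a hab).2 ha.ne, min_eq_left ha.le], hgt⟩

/-- The projection of an Arf semigroup on two coordinates is determined by the gluing. -/
theorem IsArf.exists_pair {S : AddSubmonoid (Fin d → ℕ)} (hS : IsArf S) {a b : Fin d} {x y : ℕ}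
    (hx : x ∈ proj S a) (hy : y ∈ proj S b)
    (h : ∀ t, Glued S a b t → (level S a (t + 1) ≤ x ↔ level S b (t + 1) ≤ y)) :
    ∃ β ∈ S, β a = x ∧ y ≤ β b := by
  have hM := hS.isMinArf
  obtain ⟨n, rfl⟩ := hM.exists_level_eq hx
  obtain ⟨m, rfl⟩ := hM.exists_level_eq hy
  obtain ⟨β, hβ, hβa⟩ := mem_proj.1 hx
  simp only [hM.level_le_level] at h
  by_cases hex : ∃ k ≤ n, ¬ Glued S a b k
  · classical
    have hex' : ∃ k, ¬ Glued S a b k := hex.imp fun _ h => h.2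
    set k := Nat.find hex' with hk
    have hlt : ∀ t < k, Glued S a b t := fun t ht => not_not.1 (Nat.find_min hex' ht)
    have hkn : k ≤ n := by
      obtain ⟨k', h1, h2⟩ := hex
      exact (Nat.find_min' hex' h2).trans h1
    obtain ⟨σ, hσ, hσa, hσb⟩ := hM.exists_apply_eq_level hlt hM le_rfl
      (hM.level_mem a k) (hM.level_mem b k)
    -- Failure of gluing at the first level `k` gives a vector at `s_k` on one branch and beyond it
    -- on the other; if it is beyond on `a`, it is swapped.
    have hρ : ∃ ρ ∈ S, ρ a = σ a ∧ σ b < ρ b := by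
      have hk' := Nat.find_spec hex'
      rw [← hk, hM.glued_iff] at hk'
      push Not at hk'
      obtain ⟨t, ht, γ, hγ, hγ'⟩ := hk'
      obtain rfl : t = k := by
        refine le_antisymm ht (not_lt.1 fun hlt' => ?_)
        have := hM.glued_iff.1 (hlt t hlt') t le_rfl γ hγ
        omega
      have hle := hM.level_le_iff hlt hγ
      have ea := hM.level_succ_le (n := k) (apply_mem_proj hγ a)
      have eb := hM.level_succ_le (n := k) (apply_mem_proj hγ b)
      rcases hγ' with ⟨h1, h2⟩ | ⟨h1, h2⟩
      · exact hS.good.exists_swap hσ hγ (by omega) (by omega)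
      · exact ⟨γ, hγ, by omega, by omega⟩
    obtain ⟨ρ, hρ, hρa, hρb⟩ := hρ
    have hβa' : level S a k ≤ β a := hβa ▸ hM.level_le_level.2 hkn
    rw [← hβa]
    exact hM.exists_stretch hσ hρ hβ hρa hρb (hσa ▸ hβa') _
  · push Not at hex
    have hmn : m ≤ n := by
      have := h n (hex n le_rfl)
      omega
    refine ⟨β, hβ, hβa, (hM.level_le_level.2 hmn).trans ?_⟩
    exact (hM.level_le_iff (fun t ht => hex t ht.le) hβ).1 hβa.ge

/-- An Arf semigroup is determined by its projections on the coordinates and by the gluing. -/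
theorem IsArf.mem_of_glued {S : AddSubmonoid (Fin d → ℕ)} (hS : IsArf S) {α : Fin d → ℕ}
    (hα : ∀ a, α a ∈ proj S a)
    (h : ∀ a b t, Glued S a b t → (level S a (t + 1) ≤ α a ↔ level S b (t + 1) ≤ α b)) :
    α ∈ S :=
  hS.isMinArf.mem_of_pairs fun a b => hS.exists_pair (hα a) (hα b) (h a b)

/-! ### The vectors of the nodes -/

/-- Gluing at a level implies gluing at all lower ones, so the `h`-th coordinates of the labels are
multiplicities up to the split and then zero: their sum telescopes. -/
theorem IsMinArf.exists_nodeVector_apply {S : AddSubmonoid (Fin d → ℕ)} (hS : IsMinArf S)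
    (l h : Fin d) (i : ℕ) : ∃ m, nodeVector S l i h = level S h m ∧
      ∀ t, t < m ↔ t ≤ i ∧ Glued S l h t := by
  classical
  induction i with
  | zero =>
    by_cases hg : Glued S l h 0
    · refine ⟨1, ?_, fun t => ⟨fun ht => ?_, fun ht => by omega⟩⟩
      · simp [nodeVector, node, hg, ← hS.sum_mult]
      · obtain rfl : t = 0 := by omega
        exact ⟨le_rfl, hg⟩
    · refine ⟨0, by simp [nodeVector, node, hg, hS.level_zero], fun t => ⟨fun ht => by omega, ?_⟩⟩
      rintro ⟨ht, h'⟩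
      exact absurd (IsMinArf.glued_mono (Nat.zero_le t) h') hg
  | succ i ih =>
    obtain ⟨m, hm, hiff⟩ := ih
    have hrec : nodeVector S l (i + 1) h = nodeVector S l i h + node S l (i + 1) h := by
      simp [nodeVector, Finset.sum_range_succ _ (i + 1)]
    by_cases hg : Glued S l h (i + 1)
    · obtain rfl : m = i + 1 := by
        refine le_antisymm (not_lt.1 fun hlt => ?_) ?_
        · have := ((hiff (i + 1)).1 hlt).1
          omega
        · exact (hiff i).2 ⟨le_rfl, IsMinArf.glued_mono i.le_succ hg⟩
      refine ⟨i + 2, ?_, fun t => ⟨fun ht => ?_, fun ht => by omega⟩⟩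
      · rw [hrec, hm, ← hS.sum_mult, ← hS.sum_mult, Finset.sum_range_succ _ (i + 1)]
        simp [node, hg]
      · exact ⟨by omega, IsMinArf.glued_mono (by omega) hg⟩
    · refine ⟨m, by rw [hrec, hm]; simp [node, hg], fun t => ?_⟩
      rw [hiff]
      constructor
      · exact fun h => ⟨by omega, h.2⟩
      · rintro ⟨h1, h2⟩
        refine ⟨?_, h2⟩
        by_contra hlt
        obtain rfl : t = i + 1 := by omega
        exact hg h2

theorem IsMinArf.level_succ_le_nodeVector {S : AddSubmonoid (Fin d → ℕ)} (hS : IsMinArf S)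
    (l h : Fin d) (i t : ℕ) :
    level S h (t + 1) ≤ nodeVector S l i h ↔ t ≤ i ∧ Glued S l h t := by
  obtain ⟨m, hm, hiff⟩ := hS.exists_nodeVector_apply l h i
  rw [hm, hS.level_le_level, ← hiff, Nat.succ_le_iff]

theorem IsArf.nodeVector_mem {S : AddSubmonoid (Fin d → ℕ)} (hS : IsArf S) (l : Fin d) (i : ℕ) :
    nodeVector S l i ∈ S := by
  have hM := hS.isMinArf
  refine hS.mem_of_glued (fun a => ?_) fun a b t hab => ?_
  · obtain ⟨m, hm, -⟩ := hM.exists_nodeVector_apply l a i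
    exact hm ▸ hM.level_mem a m
  · rw [hM.level_succ_le_nodeVector, hM.level_succ_le_nodeVector]
    exact and_congr_right fun _ =>
      ⟨fun h => hM.glued_trans h hab, fun h => hM.glued_trans h (hM.glued_symm hab)⟩

theorem IsMinArf.overBranching_symm {S : AddSubmonoid (Fin d → ℕ)} (hS : IsMinArf S)
    {a b : Fin d} {v : Fin d → ℕ} (h : OverBranching S a b v) : OverBranching S b a v := by
  obtain ⟨l, i, hv, k, hk, hg, hl⟩ := h
  exact ⟨l, i, hv, k, hk, fun h => hg (hS.glued_symm h), hl.symm⟩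

/-- A vector over the branching node of two branches has the coordinate of the splitting level on
one of the two branches and a greater one on the other branch. -/
theorem IsMinArf.exists_of_overBranching {S : AddSubmonoid (Fin d → ℕ)} (hS : IsMinArf S)
    {a b : Fin d} {v : Fin d → ℕ} (h : OverBranching S a b v) :
    ∃ k, (∀ t < k, Glued S a b t) ∧
      ((level S a k < v a ∧ v b = level S b k) ∨ (level S b k < v b ∧ v a = level S a k)) := by
  classical
  obtain ⟨l, i, rfl, k', hk', hg, hl⟩ := h
  have hex : ∃ k, ¬ Glued S a b k := ⟨k', hg⟩
  have hkk : Nat.find hex ≤ k' := Nat.find_min' hex hg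
  have hlt : ∀ t < Nat.find hex, Glued S a b t := fun t ht => not_not.1 (Nat.find_min hex ht)
  have hspec := Nat.find_spec hex
  refine ⟨Nat.find hex, hlt, ?_⟩
  generalize Nat.find hex = k at *
  -- Branch `l` still follows `x` at level `k`, so it leaves `y` exactly where `x` does.
  have key : ∀ x y : Fin d, ¬ Glued S x y k → (∀ t < k, Glued S x y t) → Glued S l x k' →
      level S x k < nodeVector S l i x ∧ nodeVector S l i y = level S y k := by
    intro x y hxy hxyt hlx
    have hlx' : Glued S l x k := glued_mono hkk hlx
    obtain ⟨m, hm, hm'⟩ := hS.exists_nodeVector_apply l x i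
    obtain ⟨n, hn, hn'⟩ := hS.exists_nodeVector_apply l y i
    rw [hm, hn]
    refine ⟨hS.level_strictMono x ((hm' k).2 ⟨hkk.trans hk', hlx'⟩), ?_⟩
    congr 1
    refine le_antisymm (not_lt.1 fun h => ?_) (not_lt.1 fun h => ?_)
    · exact hxy (hS.glued_trans (hS.glued_symm hlx') ((hn' k).1 h).2)
    · exact lt_irrefl n ((hn' n).2 ⟨by omega,
        hS.glued_trans (glued_mono h.le hlx') (hxyt n h)⟩)
  rcases hl with hl | hl
  · exact Or.inl (key a b hspec hlt hl)
  · exact Or.inr (key b a (fun h => hspec (hS.glued_symm h))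
      (fun t ht => hS.glued_symm (hlt t ht)) hl)

theorem IsMinArf.exists_overBranching {S : AddSubmonoid (Fin d → ℕ)} (hS : IsMinArf S)
    {a b : Fin d} (hab : a ≠ b) : ∃ v, OverBranching S a b v := by
  obtain ⟨k, hk⟩ := hS.exists_not_glued hab
  exact ⟨nodeVector S a k, a, k, rfl, k, le_rfl, hk, Or.inl (hS.glued_refl a k)⟩

/-! ### Compatible orderings -/

/-- Each branch is encoded by the sequence of least representatives of its gluing classes. Branches
glued at level `i` share the prefix up to `i`, and sequences with a common prefix form an interval
in the lexicographic order. -/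
theorem IsMinArf.exists_compatible {S : AddSubmonoid (Fin d → ℕ)} (hS : IsMinArf S) :
    ∃ pos : Equiv.Perm (Fin d), Compatible pos S := by
  classical
  have hne : ∀ (t : ℕ) (j : Fin d), (Finset.univ.filter fun h => Glued S j h t).Nonempty :=
    fun t j => ⟨j, by simp [hS.glued_refl]⟩
  set r : ℕ → Fin d → Fin d := fun t j => (Finset.univ.filter fun h => Glued S j h t).min' (hne t j)
    with hr
  have hrg : ∀ t j, Glued S j (r t j) t := fun t j => by
    have := Finset.min'_mem _ (hne t j)
    simpa using this
  have hreq : ∀ t j h, r t j = r t h ↔ Glued S j h t := by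
    intro t j h
    refine ⟨fun e => hS.glued_trans (hrg t j) (e ▸ hS.glued_symm (hrg t h)), fun e => ?_⟩
    have : (Finset.univ.filter fun x => Glued S j x t) =
        Finset.univ.filter fun x => Glued S h x t := by
      ext x
      simp only [Finset.mem_filter, Finset.mem_univ, true_and]
      exact ⟨hS.glued_trans (hS.glued_symm e), hS.glued_trans e⟩
    simp only [hr, this]
  let f : Fin d → Lex (ℕ → Fin d) := fun j => toLex fun t => r t j
  refine ⟨(Tuple.sort f).symm, fun j h l hjh hhl i hg => ?_⟩
  have hmono := Tuple.monotone_sort f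
  have h1 : f j ≤ f h := by simpa using hmono hjh
  have h2 : f h ≤ f l := by simpa using hmono hhl
  have hjl : ∀ t ≤ i, r t j = r t l := fun t ht =>
    (hreq t j l).2 (IsMinArf.glued_mono ht hg)
  by_contra hjh'
  have hex : ∃ t, r t j ≠ r t h := ⟨i, fun e => hjh' ((hreq i j h).1 e)⟩
  have hti : Nat.find hex ≤ i := Nat.find_min' hex fun e => hjh' ((hreq i j h).1 e)
  have hlt : ∀ t < Nat.find hex, r t j = r t h := fun t ht => not_not.1 (Nat.find_min hex ht)
  have hspec := Nat.find_spec hex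
  generalize Nat.find hex = t at *
  have hlast : ∀ x y : Fin d, f x ≤ f y → (∀ u < t, r u x = r u y) → r t x ≤ r t y := by
    intro x y hxy hu
    by_contra hlt'
    exact absurd hxy (not_le.2 ⟨t, fun u hu' => (hu u hu').symm, not_le.1 hlt'⟩)
  have e1 := hlast j h h1 hlt
  have e2 := hlast h l h2 fun u hu => (hlt u hu).symm.trans (hjl u (by omega))
  rw [← hjl t hti] at e2
  exact hspec (le_antisymm e1 e2)

/-- In a semigroup compatible with the ordering, the gluing conditions for pairs of consecutive
branches imply those for all the pairs. -/
theorem Compatible.level_le_iff {A : AddSubmonoid (Fin d → ℕ)} {pos : Equiv.Perm (Fin d)}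
    (hpos : Compatible pos A) (hA : IsMinArf A) {α : Fin d → ℕ}
    (h : ∀ a b, Consecutive pos a b → ∃ β ∈ A, β a = α a ∧ β b = α b) (a b : Fin d) (t : ℕ)
    (hab : Glued A a b t) : level A a (t + 1) ≤ α a ↔ level A b (t + 1) ≤ α b := by
  have key : ∀ n (a b : Fin d), (pos b : ℕ) = pos a + n → Glued A a b t →
      (level A a (t + 1) ≤ α a ↔ level A b (t + 1) ≤ α b) := by
    intro n
    induction n with
    | zero =>
      intro a b he _
      obtain rfl : b = a := pos.injective (Fin.ext he)
      rfl
    | succ n ih =>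
      intro a b he hg
      obtain ⟨c, hc⟩ := pos.surjective ⟨pos a + n, by omega⟩
      have hc' : (pos c : ℕ) = pos a + n := by rw [hc]
      have hac : Glued A a c t := hpos a c b (Fin.le_def.2 (by omega)) (Fin.le_def.2 (by omega)) t hg
      have hcb : Glued A c b t := hA.glued_trans (hA.glued_symm hac) hg
      obtain ⟨β, hβ, hβc, hβb⟩ := h c b (by unfold Consecutive; omega)
      rw [ih a c hc' hac, ← hβc, ← hβb]
      exact hA.glued_iff.1 hcb t le_rfl β hβ
  rcases le_total (pos a : ℕ) (pos b) with hle | hle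
  · exact key (pos b - pos a) a b (by omega) hab
  · exact (key (pos a - pos b) b a (by omega) (hA.glued_symm hab)).symm

/-! ### The sets `V` -/

theorem IsMinArf.exists_minimalVector {S : AddSubmonoid (Fin d → ℕ)} (hS : IsMinArf S)
    {j : Fin d} {c : ℕ} (hc : c ∈ proj S j) : ∃ v, IsLeast {α | α ∈ S ∧ α j = c} v := by
  obtain ⟨β, hβ, hβj⟩ := mem_proj.1 hc
  obtain ⟨v, hv, hmin⟩ := WellFounded.has_min (wellFounded_lt (α := Fin d → ℕ))
    {α | α ∈ S ∧ α j = c} ⟨β, hβ, hβj⟩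
  refine ⟨v, hv, fun α hα => ?_⟩
  -- Closure under minima turns a minimal element into a least one.
  have hmem : v ⊓ α ∈ {α | α ∈ S ∧ α j = c} :=
    ⟨hS.inf_mem v hv.1 α hα.1, by simp [hv.2, hα.2]⟩
  by_contra hle
  exact hmin _ hmem (inf_lt_left.2 hle)

theorem IsMinArf.finite_minimalVectors {S : AddSubmonoid (Fin d → ℕ)} (hS : IsMinArf S) :
    (minimalVectors S).Finite := by
  have : minimalVectors S ⊆ ⋃ j : Fin d, ⋃ c ∈ arfCharacters (proj S j),
      {v | IsLeast {α | α ∈ S ∧ α j = c} v} := by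
    rintro v ⟨j, c, hc, hv⟩
    simp only [Set.mem_iUnion]
    exact ⟨j, c, hc, hv⟩
  refine (Set.finite_iUnion fun j => ?_).subset this
  exact (finite_arfCharacters (hS.isArfNumerical_proj j)).biUnion fun c _ =>
    Set.Subsingleton.finite fun v hv w hw => hv.unique hw

theorem IsMinArf.exists_isCharacterSet {S : AddSubmonoid (Fin d → ℕ)} (hS : IsMinArf S)
    (pos : Equiv.Perm (Fin d)) : ∃ V, IsCharacterSet pos S V := by
  classical
  have hex : ∀ p : Fin d × Fin d, ∃ v, Consecutive pos p.1 p.2 → OverBranching S p.1 p.2 v := by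
    intro p
    by_cases hp : Consecutive pos p.1 p.2
    · obtain ⟨v, hv⟩ := hS.exists_overBranching (a := p.1) (b := p.2) fun e => by
        rw [e, Consecutive] at hp
        omega
      exact ⟨v, fun _ => hv⟩
    · exact ⟨0, fun h => absurd h hp⟩
  choose w hw using hex
  refine ⟨_, {p | Consecutive pos p.1 p.2 ∧ ¬ ∃ v ∈ minimalVectors S, OverBranching S p.1 p.2 v},
    w, fun p hp => ⟨hp.1, hp.2, hw p hp.1⟩, rfl, fun a b hab => ?_⟩
  by_cases h : ∃ v ∈ minimalVectors S, OverBranching S a b v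
  · obtain ⟨v, hv, hv'⟩ := h
    exact ⟨v, Or.inl hv, hv'⟩
  · exact ⟨w (a, b), Or.inr ⟨(a, b), ⟨hab, h⟩, rfl⟩, hw (a, b) hab⟩

theorem IsCharacterSet.finite {S : AddSubmonoid (Fin d → ℕ)} (hS : IsMinArf S)
    {pos : Equiv.Perm (Fin d)} {V : Set (Fin d → ℕ)} (hV : IsCharacterSet pos S V) : V.Finite := by
  obtain ⟨J, w, -, rfl, -⟩ := hV
  exact hS.finite_minimalVectors.union (J.toFinite.image w)

theorem IsCharacterSet.subset {S : AddSubmonoid (Fin d → ℕ)} (hS : IsArf S)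
    {pos : Equiv.Perm (Fin d)} {V : Set (Fin d → ℕ)} (hV : IsCharacterSet pos S V) :
    V ⊆ (S : Set (Fin d → ℕ)) := by
  obtain ⟨J, w, hw, rfl, -⟩ := hV
  rintro v (⟨j, c, -, hv⟩ | ⟨p, hp, rfl⟩)
  · exact hv.1.1
  · obtain ⟨l, i, hwp, -⟩ := (hw p hp).2.2
    exact hwp ▸ hS.nodeVector_mem l i

/-- The intersection of `S` with an Arf semigroup that contains the minimal vectors has the same
projections as `S`. -/
theorem IsMinArf.proj_le_proj_inf {S A : AddSubmonoid (Fin d → ℕ)} (hS : IsMinArf S)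
    (hA : IsMinArf A) (h : minimalVectors S ⊆ (A : Set (Fin d → ℕ))) (j : Fin d) :
    proj S j ≤ proj (S ⊓ A) j := by
  refine le_of_essential_subset ((hS.inter hA).isArfNumerical_proj j) fun c hc => ?_
  obtain ⟨v, hv⟩ := hS.exists_minimalVector hc.1
  refine mem_proj.2 ⟨v, ⟨hv.1.1, h ⟨j, c, ?_, hv⟩⟩, hv.1.2⟩
  rwa [arfCharacters_eq_essential (hS.isArfNumerical_proj j)]

/-- If `A` contains the minimal vectors of `S` and a vector over the branching node of `a` and `b`,
then its projection on these two coordinates contains that of `S`. -/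
theorem IsMinArf.exists_pair_of_overBranching {S A : AddSubmonoid (Fin d → ℕ)} (hS : IsMinArf S)
    (hA : IsArf A) (h : minimalVectors S ⊆ (A : Set (Fin d → ℕ))) {a b : Fin d} {v : Fin d → ℕ}
    (hvA : v ∈ A) (hv : OverBranching S a b v) {α : Fin d → ℕ} (hα : α ∈ S) :
    ∃ β ∈ A, β a = α a ∧ α b ≤ β b := by
  have hAM := hA.isMinArf
  have hproj := hS.proj_le_proj_inf hAM h
  obtain ⟨k, hk, hvk⟩ := hS.exists_of_overBranching hv
  -- The lift is taken in `S ⊓ A`: above the split it is stretched inside `A`, while below the split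
  -- the gluing of `S` bounds its `b`-th coordinate from below.
  obtain ⟨β, ⟨hβS, hβA⟩, hβa⟩ := mem_proj.1 (hproj a (apply_mem_proj hα a))
  by_cases hka : level S a k ≤ α a
  · obtain ⟨σ, hσ, hσa, hσb⟩ := hS.exists_apply_eq_level hk (hS.inter hAM) inf_le_left
      (hproj a (hS.level_mem a k)) (hproj b (hS.level_mem b k))
    have hρ : ∃ ρ ∈ A, ρ a = σ a ∧ σ b < ρ b := by
      rcases hvk with ⟨h1, h2⟩ | ⟨h1, h2⟩
      · exact hA.good.exists_swap hσ.2 hvA (hσa ▸ h1) (hσb ▸ h2)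
      · exact ⟨v, hvA, h2.trans hσa.symm, hσb ▸ h1⟩
    obtain ⟨ρ, hρ, hρa, hρb⟩ := hρ
    have hβa' : level S a k ≤ β a := hβa ▸ hka
    rw [← hβa]
    exact hAM.exists_stretch hσ.2 hρ hβA hρa hρb (hσa ▸ hβa') _
  · obtain ⟨n, hn⟩ := hS.exists_level_eq (apply_mem_proj hα a)
    obtain ⟨m, hm⟩ := hS.exists_level_eq (apply_mem_proj hα b)
    have hnk : n < k := by
      rw [← hn, hS.level_le_level] at hka
      omega
    have hmn : m ≤ n := by
      have := hS.level_le_iff (k := n + 1) (fun t ht => hk t (by omega)) hα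
      rw [← hn, ← hm, hS.level_le_level, hS.level_le_level] at this
      omega
    refine ⟨β, hβA, hβa, hm ▸ (hS.level_le_level.2 hmn).trans ?_⟩
    exact (hS.level_le_iff (fun t ht => hk t (by omega)) hβS).1 (hn.trans hβa.symm).le

theorem IsCharacterSet.le {S A : AddSubmonoid (Fin d → ℕ)} (hS : IsMinArf S)
    {pos : Equiv.Perm (Fin d)} {V : Set (Fin d → ℕ)} (hV : IsCharacterSet pos S V) (hA : IsArf A)
    (hpos : Compatible pos A) (hVA : V ⊆ (A : Set (Fin d → ℕ))) : S ≤ A := by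
  obtain ⟨J, w, -, hVeq, hcov⟩ := hV
  have hmin : minimalVectors S ⊆ (A : Set (Fin d → ℕ)) :=
    (hVeq ▸ Set.subset_union_left : minimalVectors S ⊆ V).trans hVA
  have hAM := hA.isMinArf
  intro α hα
  refine hA.mem_of_glued (fun a => ?_) (hpos.level_le_iff hAM fun a b hab => ?_)
  · obtain ⟨β, hβ, hβa⟩ := mem_proj.1 (hS.proj_le_proj_inf hAM hmin a (apply_mem_proj hα a))
    exact mem_proj.2 ⟨β, hβ.2, hβa⟩
  · obtain ⟨v, hvV, hv⟩ := hcov a b hab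
    obtain ⟨β, hβ, hβa, hβb⟩ := hS.exists_pair_of_overBranching hA hmin (hVA hvV) hv hα
    obtain ⟨γ, hγ, hγb, hγa⟩ :=
      hS.exists_pair_of_overBranching hA hmin (hVA hvV) (hS.overBranching_symm hv) hα
    -- Each of `β`, `γ` is exact on one branch and large enough on the other, so the minimum is
    -- exact on both.
    exact ⟨β ⊓ γ, hAM.inf_mem β hβ γ hγ, by simp [hβa, hγa], by simp [hγb, hβb]⟩

end ArfSemigroup

theorem theorem5p3 (d : ℕ) (S : AddSubmonoid (Fin d → ℕ)) (hS : ArfSemigroup.IsArf S)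
    (hloc : ArfSemigroup.IsLocal (S : Set (Fin d → ℕ))) :
    (∃ pos : Equiv.Perm (Fin d), ArfSemigroup.Compatible pos S) ∧
    ∀ pos : Equiv.Perm (Fin d), ArfSemigroup.Compatible pos S →
      (∃ V : Set (Fin d → ℕ), ArfSemigroup.IsCharacterSet pos S V) ∧
      ∀ V : Set (Fin d → ℕ), ArfSemigroup.IsCharacterSet pos S V →
        V.Finite ∧ V ⊆ (S : Set (Fin d → ℕ)) ∧
        IsLeast {A : AddSubmonoid (Fin d → ℕ) | ArfSemigroup.IsArf A ∧
          ArfSemigroup.Compatible pos A ∧ V ⊆ (A : Set (Fin d → ℕ))} S := by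
  have hM := hS.isMinArf
  refine ⟨hM.exists_compatible, fun pos hpos => ⟨hM.exists_isCharacterSet pos, fun V hV => ?_⟩⟩
  exact ⟨hV.finite hM, hV.subset hS, ⟨hS, hpos, hV.subset hS⟩,
    fun A hA => hV.le hM hA.1 hA.2.1 hA.2.2⟩
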